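/- Let $H$ be a complex Hilbert space and $1<p<\infty$. Let $S^p(H)$ be the Schatten space of all bounded operators $x$ on $H$ with $\operatorname{tr}(|x|^p)<\infty$, with norm $\|x\|_p=\operatorname{tr}(|x|^p)^{1/p}$. A subspace of $S^p(H)$ is called positively 1-complemented if it is the range of a linear projection $P:S^p(H)\to S^p(H)$ that is contractive ($\|P(x)\|_p\le\|x\|_p$ for all $x$) and positive ($P(x)\ge 0$ whenever $x\ge 0$). Two subspaces $X_1,X_2\subset S^p(H)$ are operator-disjoint if $x_1^*x_2=0$ and $x_1x_2^*=0$ for all $x_1\in X_1$, $x_2\in X_2$. A subspace is indecomposable if it is not the sum of two nonzero operator-disjoint subspaces. Let $X\subset S^p(H)$ be a subspace and consider any decomposition $X=\bigoplus^p_\alpha X_\alpha$ with a family $(X_\alpha)_\alpha$ of pairwise operator-disjoint indecomposable subspaces of $S^p(H)$; that is, $X$ is the set of all sums $\sum_\alpha x_\alpha$, convergent in $S^p(H)$, with $x_\alpha\in X_\alpha$ for every $\alpha$ and $\sum_\alpha\|x_\alpha\|_p^p<\infty$. Then $X$ is positively 1-complemented if and only if every $X_\alpha$ is positively 1-complemented.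 -/

import Mathlib

open scoped ENNReal Topology InnerProductSpace

namespace PosSchatten

section Defs

variable {H : Type*} [NormedAddCommGroup H] [InnerProductSpace ℂ H] [CompleteSpace H]

/-- The trace `∑ᵢ ⟨eᵢ, a eᵢ⟩ ∈ [0, ∞]` of a positive operator `a` on `H`, computed in some
Hilbert basis `(eᵢ)` of `H`; see `trace_eq_tsum` for the independence of the basis. -/
noncomputable def trace (a : H →L[ℂ] H) : ℝ≥0∞ :=
  ∑' i, ENNReal.ofReal
    (⟪(exists_hilbertBasis ℂ H).choose_spec.choose i,
      a ((exists_hilbertBasis ℂ H).choose_spec.choose i)⟫_ℂ).re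

/-- The Schatten norm `(tr |x|^p)^(1/p) ∈ [0, ∞]` of a bounded operator, where
`|x| = (x⋆ x)^(1/2)` and the powers are given by the continuous functional calculus. -/
noncomputable def schattenNorm (p : ℝ) (x : H →L[ℂ] H) : ℝ≥0∞ :=
  trace (CFC.abs x ^ p) ^ (1 / p)

variable (H) in
/-- The Schatten space `S^p(H)`, as a set of bounded operators: those with `tr |x|^p < ∞`. -/
def schatten (p : ℝ) : Set (H →L[ℂ] H) :=
  {x | trace (CFC.abs x ^ p) < ∞}

/-- Two operators are disjoint if `x⋆ y = 0` and `x y⋆ = 0` (`star` is the adjoint). -/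
def Disjoint (x y : H →L[ℂ] H) : Prop :=
  star x * y = 0 ∧ x * star y = 0

/-- Two subspaces are operator-disjoint if each element of the first is disjoint from each
element of the second. -/
def OperatorDisjoint (X Y : Submodule ℂ (H →L[ℂ] H)) : Prop :=
  ∀ x ∈ X, ∀ y ∈ Y, Disjoint x y

/-- A subspace is indecomposable if it is not the sum of two nonzero operator-disjoint
subspaces. (Such a sum is automatically direct, and a `p`-sum for the `S^p`-norm.) -/
def Indecomposable (X : Submodule ℂ (H →L[ℂ] H)) : Prop :=
  ¬ ∃ Y Z : Submodule ℂ (H →L[ℂ] H),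
    Y ≠ ⊥ ∧ Z ≠ ⊥ ∧ OperatorDisjoint Y Z ∧ X = Y ⊔ Z

/-- The (unordered) series `∑ f α` converges to `x` in the norm of `S^p(H)`. -/
def HasSchattenSum {ι : Type*} (p : ℝ) (f : ι → H →L[ℂ] H) (x : H →L[ℂ] H) : Prop :=
  Filter.Tendsto (fun s : Finset ι => schattenNorm p (x - ∑ α ∈ s, f α)) Filter.atTop (𝓝 0)

/-- `X` is the internal `p`-direct sum of the pairwise operator-disjoint subspaces `Y α`:
the `Y α` are pairwise operator-disjoint, and `X` consists of the sums in `S^p(H)` of the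
families `(f α)` with `f α ∈ Y α` and `∑ ‖f α‖_p ^ p < ∞`. -/
structure IsPDirectSum {ι : Type*} (p : ℝ) (X : Submodule ℂ (H →L[ℂ] H))
    (Y : ι → Submodule ℂ (H →L[ℂ] H)) : Prop where
  pairwise_disjoint : Pairwise fun α β => OperatorDisjoint (Y α) (Y β)
  mem_iff : ∀ x, x ∈ X ↔ ∃ f : ι → H →L[ℂ] H,
    (∀ α, f α ∈ Y α) ∧ ∑' α, schattenNorm p (f α) ^ p < ∞ ∧ HasSchattenSum p f x

/-- `P` restricts to a positive contractive linear projection `S^p(H) → S^p(H)`. The values of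
`P` outside `S^p(H)` are irrelevant. -/
structure IsPositiveContractiveProjection (p : ℝ) (P : (H →L[ℂ] H) → (H →L[ℂ] H)) : Prop where
  map_mem : ∀ x ∈ schatten H p, P x ∈ schatten H p
  map_add : ∀ x ∈ schatten H p, ∀ y ∈ schatten H p, P (x + y) = P x + P y
  map_smul : ∀ (c : ℂ), ∀ x ∈ schatten H p, P (c • x) = c • P x
  idempotent : ∀ x ∈ schatten H p, P (P x) = P x
  contractive : ∀ x ∈ schatten H p, schattenNorm p (P x) ≤ schattenNorm p x
  positive : ∀ x ∈ schatten H p, x.IsPositive → (P x).IsPositive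

/-- `X` is positively 1-complemented in `S^p(H)`: it is the range of a positive contractive
projection `S^p(H) → S^p(H)`. -/
def PositivelyOneComplemented (p : ℝ) (X : Submodule ℂ (H →L[ℂ] H)) : Prop :=
  ∃ P : (H →L[ℂ] H) → (H →L[ℂ] H),
    IsPositiveContractiveProjection p P ∧ P '' schatten H p = (X : Set (H →L[ℂ] H))

set_option linter.unusedSectionVars false in
theorem ofReal_norm_sq_eq_tsum {ι : Type*} (b : HilbertBasis ι ℂ H) (v : H) :
    ENNReal.ofReal (‖v‖ ^ 2) = ∑' i, ENNReal.ofReal (‖⟪b i, v⟫_ℂ‖ ^ 2) := by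
  have h := b.hasSum_inner_mul_inner v v
  have h2 : HasSum (fun i => ‖⟪b i, v⟫_ℂ‖ ^ 2) (‖v‖ ^ 2) := by
    have h3 := Complex.hasSum_re h
    convert h3 using 1
    · funext i
      rw [← inner_conj_symm v (b i), Complex.conj_mul', ← Complex.ofReal_pow, Complex.ofReal_re]
    · rw [inner_self_eq_norm_sq_to_K]
      norm_cast
  rw [← h2.tsum_eq, ENNReal.ofReal_tsum_of_nonneg (fun i => by positivity) h2.summable]

theorem tsum_norm_sq_eq {ι κ : Type*} (b : HilbertBasis ι ℂ H) (c : HilbertBasis κ ℂ H)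
    (t : H →L[ℂ] H) (ht : IsSelfAdjoint t) :
    ∑' i, ENNReal.ofReal (‖t (b i)‖ ^ 2) = ∑' j, ENNReal.ofReal (‖t (c j)‖ ^ 2) := by
  simp_rw [ofReal_norm_sq_eq_tsum c (t (b _))]
  rw [ENNReal.tsum_comm]
  simp_rw [ofReal_norm_sq_eq_tsum b (t (c _))]
  refine tsum_congr fun j => tsum_congr fun i => ?_
  rw [← ContinuousLinearMap.adjoint_inner_left, ht.adjoint_eq, norm_inner_symm]

theorem trace_eq_tsum {ι : Type*} (b : HilbertBasis ι ℂ H) (a : H →L[ℂ] H) (ha : 0 ≤ a) :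
    trace a = ∑' i, ENNReal.ofReal (⟪b i, a (b i)⟫_ℂ).re := by
  have hs : IsSelfAdjoint (CFC.sqrt a) := IsSelfAdjoint.of_nonneg (CFC.sqrt_nonneg a)
  have key : ∀ v : H, (⟪v, a v⟫_ℂ).re = ‖CFC.sqrt a v‖ ^ 2 := by
    intro v
    have h1 : a v = CFC.sqrt a (CFC.sqrt a v) := by
      conv_lhs => rw [← CFC.sqrt_mul_sqrt_self a ha]
      rfl
    rw [h1, ← ContinuousLinearMap.adjoint_inner_left, hs.adjoint_eq, inner_self_eq_norm_sq_to_K]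
    norm_cast
  unfold trace
  simp_rw [key]
  exact tsum_norm_sq_eq _ b _ hs

end Defs

end PosSchatten

set_option linter.unusedSectionVars false

namespace PosSchatten

universe u

variable {H : Type u} [NormedAddCommGroup H] [InnerProductSpace ℂ H] [CompleteSpace H]

/-! Every norm estimate comes from one variational fact: `∑ |⟪hⱼ, x gⱼ⟫|^p ≤ tr |x|^p` for
orthonormal systems `g`, `h` (`tsum_inner_rpow_le`), with equality at the singular vectors of a
compact `x`. Testing on concatenated singular systems shows that the `p`-th power of the norm is
subadditive on disjoint sums, that a disjoint summand has no larger norm than the sum, and that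
compression to orthogonal blocks is `p`-contractive.

If `P` projects onto `X`, the map sending `x` to the `Y i`-component of `P x` projects onto `Y i`.
Components are unique (`eq_of_hasSum_of_hasSum`), hence linear in `x`; they do not increase the norm
(`traceAbsRpow_le_of_disjoint`), and a disjoint summand of a positive sum is positive
(`nonneg_of_disjoint_of_add_nonneg`).

Conversely, given projections `P i` onto `Y i`, let `q i` project onto the closed span of the ranges
of `Y i`. Positivity makes `P i` commute with adjoints, so `Y i` is self-adjoint and `q i * y * q i
= y` on it. The `q i` are mutually orthogonal, and `x ↦ ∑ P i (q i * x * q i)` is the desired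
projection. -/

theorem inner_star_left (a : H →L[ℂ] H) (v w : H) : ⟪star a v, w⟫_ℂ = ⟪v, a w⟫_ℂ :=
  ContinuousLinearMap.adjoint_inner_left a w v

theorem inner_star_right (a : H →L[ℂ] H) (v w : H) : ⟪v, star a w⟫_ℂ = ⟪a v, w⟫_ℂ :=
  ContinuousLinearMap.adjoint_inner_right a v w

/-! ### Compactness of Schatten operators. -/

theorem norm_apply_sq_le (x : H →L[ℂ] H) (v : H) : ‖x v‖ ^ 2 ≤ ‖v‖ * ‖(star x * x) v‖ := by
  have h : ‖x v‖ ^ 2 = (⟪v, (star x * x) v⟫_ℂ).re := by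
    rw [mul_apply_eq_comp, inner_star_right, inner_self_eq_norm_sq_to_K]
    norm_cast
  rw [h]
  exact (Complex.re_le_norm _).trans (norm_inner_le_norm _ _)

theorem isCompactOperator_of_star_mul_self {x : H →L[ℂ] H}
    (hx : IsCompactOperator (star x * x : H →L[ℂ] H)) : IsCompactOperator x := by
  have hc := (hx.isCompact_closure_image_closedBall
    (f := ((star x * x : H →L[ℂ] H) : H →ₗ[ℂ] H)) 1).totallyBounded.subset subset_closure
  refine (isCompactOperator_iff_isCompact_closure_image_closedBall (x : H →ₗ[ℂ] H)
    one_pos).2 (TotallyBounded.isCompact_of_isClosed ?_ isClosed_closure)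
  refine TotallyBounded.closure (Metric.totallyBounded_iff.2 fun ε hε => ?_)
  -- The bound `‖x u‖² ≤ ‖u‖ ‖x⋆x u‖` with `‖u‖ ≤ 2` turns an `ε²/2`-net for `x⋆x` into an `ε`-net
  -- for `x`. The net is taken inside the image of the ball so that its points can be pulled back.
  obtain ⟨t, ht, htf, hcov⟩ := hc.exists_subset (Metric.dist_mem_uniformity
    (show 0 < ε ^ 2 / 2 by positivity))
  obtain ⟨t', ht', htf', hcov'⟩ := (Set.exists_subset_image_finite_and
    (p := fun s => ((star x * x : H →L[ℂ] H) : H →ₗ[ℂ] H) '' Metric.closedBall 0 1 ⊆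
      ⋃ y ∈ s, {z | dist z y < ε ^ 2 / 2})).1 ⟨t, ht, htf, hcov⟩
  refine ⟨x '' t', htf'.image _, ?_⟩
  rintro _ ⟨v, hv, rfl⟩
  obtain ⟨_, ⟨w, hw, rfl⟩, hvw⟩ := Set.mem_iUnion₂.1 (hcov' ⟨v, hv, rfl⟩)
  refine Set.mem_iUnion₂.2 ⟨x w, ⟨w, hw, rfl⟩, ?_⟩
  simp only [Set.mem_ofPred_eq, ContinuousLinearMap.coe_coe, dist_eq_norm, ← map_sub] at hvw
  rw [Metric.mem_ball, dist_eq_norm, ContinuousLinearMap.coe_coe, ← map_sub]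
  refine lt_of_pow_lt_pow_left₀ 2 hε.le ((norm_apply_sq_le x _).trans_lt ?_)
  have h2 : ‖v - w‖ ≤ 2 := by
    have h3 := ht' hw
    rw [mem_closedBall_zero_iff] at hv h3
    linarith [norm_sub_le v w]
  nlinarith [norm_nonneg ((star x * x) (v - w)), norm_nonneg (v - w)]

/-- The rank one operator `v ↦ ⟪b, v⟫ w`. -/
noncomputable def rankOne (b w : H) : H →L[ℂ] H :=
  (ContinuousLinearMap.toSpanSingleton ℂ w).comp (innerSL ℂ b)

theorem rankOne_apply (b w v : H) : rankOne b w v = ⟪b, v⟫_ℂ • w := by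
  simp [rankOne]

theorem isCompactOperator_rankOne (b w : H) : IsCompactOperator (rankOne b w) :=
  (isCompactOperator_of_locallyCompactSpace_dom (innerSL ℂ b)).clm_comp
    (ContinuousLinearMap.toSpanSingleton ℂ w)

theorem isCompactOperator_finset_sum {ι : Type*} (F : Finset ι) (f : ι → H →L[ℂ] H)
    (h : ∀ i ∈ F, IsCompactOperator (f i)) : IsCompactOperator (∑ i ∈ F, f i : H →L[ℂ] H) :=
  Submodule.sum_mem (compactOperator (RingHom.id ℂ) H H) h

/-- Hilbert–Schmidt operators are norm limits of finite-rank truncations: by Cauchy–Schwarz in each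
coordinate, the squared norm of the remainder is at most the tail of the series. -/
theorem isCompactOperator_of_tsum_norm_sq {ι : Type*} (b : HilbertBasis ι ℂ H) (t : H →L[ℂ] H)
    (ht : IsSelfAdjoint t) (h : ∑' i, ENNReal.ofReal (‖t (b i)‖ ^ 2) ≠ ∞) :
    IsCompactOperator t := by
  classical
  refine isCompactOperator_of_tendsto (l := Filter.atTop)
    (F := fun F : Finset ι => ∑ i ∈ F, rankOne (t (b i)) (b i)) ?_ (.of_forall fun F =>
      isCompactOperator_finset_sum _ _ fun i _ => isCompactOperator_rankOne _ _)
  rw [tendsto_iff_edist_tendsto_0]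
  have h0 := ENNReal.tendsto_tsum_compl_atTop_zero h
  have h1 := (ENNReal.continuous_rpow_const (y := (1 / 2 : ℝ))).tendsto 0 |>.comp h0
  simp only [one_div, ENNReal.zero_rpow_of_pos (show (0:ℝ) < 2⁻¹ by norm_num)] at h1
  refine tendsto_of_tendsto_of_tendsto_of_le_of_le tendsto_const_nhds h1 (fun _ => zero_le)
    fun F => ?_
  set r : H →L[ℂ] H := t - ∑ i ∈ F, rankOne (t (b i)) (b i) with hr
  set c : ℝ≥0∞ := ∑' i : {x // x ∉ F}, ENNReal.ofReal (‖t (b i)‖ ^ 2) with hc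
  have hcf : c ≠ ∞ := ((ENNReal.tsum_comp_le_tsum_of_injective Subtype.val_injective
    (fun i => ENNReal.ofReal (‖t (b i)‖ ^ 2))).trans_lt h.lt_top).ne
  have hrb (v : H) (j : ι) : ⟪b j, r v⟫_ℂ = if j ∈ F then 0 else ⟪t (b j), v⟫_ℂ := by
    have h3 : ⟪b j, t v⟫_ℂ = ⟪t (b j), v⟫_ℂ := by rw [← inner_star_left, ht.star_eq]
    simp only [hr, sub_apply, sum_apply, rankOne_apply, inner_sub_right,
      inner_sum, inner_smul_right, orthonormal_iff_ite.1 b.orthonormal, h3]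
    simp only [mul_ite, mul_one, mul_zero, Finset.sum_ite_eq]
    split_ifs <;> simp
  have hv (v : H) : ENNReal.ofReal (‖r v‖ ^ 2) ≤ c * ENNReal.ofReal (‖v‖ ^ 2) := by
    have h4 : c = ∑' j, if j ∈ F then 0 else ENNReal.ofReal (‖t (b j)‖ ^ 2) := by
      rw [hc]
      refine (tsum_subtype {j | j ∉ F} (fun i => ENNReal.ofReal (‖t (b i)‖ ^ 2))).trans ?_
      refine tsum_congr fun j => ?_
      by_cases hj : j ∈ F <;> simp [Set.indicator, hj]
    rw [ofReal_norm_sq_eq_tsum b, h4, ← ENNReal.tsum_mul_right]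
    refine ENNReal.tsum_le_tsum fun j => ?_
    rw [hrb]
    split_ifs
    · simp
    · rw [← ENNReal.ofReal_mul (by positivity), ← mul_pow]
      exact ENNReal.ofReal_le_ofReal (by gcongr; exact norm_inner_le_norm _ _)
  have hrn : ‖r‖ ≤ (c ^ (2⁻¹ : ℝ)).toReal := by
    refine ContinuousLinearMap.opNorm_le_bound _ ENNReal.toReal_nonneg fun v => ?_
    refine le_of_pow_le_pow_left₀ two_ne_zero (by positivity) ?_
    have h5 := ENNReal.toReal_mono (ENNReal.mul_ne_top hcf ENNReal.ofReal_ne_top) (hv v)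
    rw [ENNReal.toReal_mul, ENNReal.toReal_ofReal (by positivity),
      ENNReal.toReal_ofReal (by positivity)] at h5
    rw [mul_pow, ← ENNReal.toReal_pow, ← ENNReal.rpow_natCast, ← ENNReal.rpow_mul]
    simpa using h5
  rw [edist_comm, edist_eq_enorm_sub]
  change ‖r‖ₑ ≤ c ^ (2⁻¹ : ℝ)
  rw [← ofReal_norm]
  exact ENNReal.ofReal_le_of_le_toReal hrn

theorem isCompactOperator_of_pow_two_pow {a : H →L[ℂ] H} (ha : IsSelfAdjoint a) (n : ℕ)
    (h : IsCompactOperator (a ^ 2 ^ n : H →L[ℂ] H)) : IsCompactOperator a := by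
  induction n with
  | zero => simpa using h
  | succ n ih =>
    refine ih (isCompactOperator_of_star_mul_self ?_)
    rwa [(ha.pow _).star_eq, ← pow_add, ← two_mul, ← pow_succ']

theorem isCompactOperator_of_trace_lt_top {c : H →L[ℂ] H} (hc : 0 ≤ c) (h : trace c < ∞) :
    IsCompactOperator c := by
  obtain ⟨w, b, -⟩ := exists_hilbertBasis ℂ H
  have hs : IsSelfAdjoint (CFC.sqrt c) := IsSelfAdjoint.of_nonneg (CFC.sqrt_nonneg c)
  have hk : IsCompactOperator (CFC.sqrt c : H →L[ℂ] H) := by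
    refine isCompactOperator_of_tsum_norm_sq b _ hs ?_
    rw [trace_eq_tsum b c hc] at h
    convert h.ne using 4 with i
    conv_rhs => rw [← CFC.sqrt_mul_sqrt_self c hc, mul_apply_eq_comp,
      ← inner_star_left, hs.star_eq, inner_self_eq_norm_sq_to_K]
    norm_cast
  rw [← CFC.sqrt_mul_sqrt_self c hc]
  exact hk.comp_clm (CFC.sqrt c)

theorem isCompactOperator_of_mem_schatten {p : ℝ} (hp : 0 < p) {x : H →L[ℂ] H}
    (hx : x ∈ schatten H p) : IsCompactOperator x := by
  have hA : 0 ≤ CFC.abs x := CFC.abs_nonneg x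
  have h1 : IsCompactOperator (CFC.abs x ^ p : H →L[ℂ] H) :=
    isCompactOperator_of_trace_lt_top CFC.rpow_nonneg hx
  lift p to NNReal using hp.le
  have hp' : 0 < p := by exact_mod_cast hp
  rw [← CFC.nnrpow_eq_rpow hp'] at h1
  -- A power of two above `p`: `|x|^(2^n)` factors through the compact `|x|^p`, and `n` square roots
  -- then lead back to `|x|`.
  obtain ⟨n, hn⟩ : ∃ n : ℕ, p < 2 ^ n := pow_unbounded_of_one_lt p one_lt_two
  have h2 : IsCompactOperator (CFC.abs x ^ 2 ^ n : H →L[ℂ] H) := by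
    have h3 : CFC.abs x ^ 2 ^ n = CFC.abs x ^ p * CFC.abs x ^ (2 ^ n - p) := by
      rw [← CFC.nnrpow_add hp' (tsub_pos_of_lt hn), add_tsub_cancel_of_le hn.le,
        CFC.nnrpow_eq_rpow (by positivity), ← CFC.rpow_natCast _ _ hA]
      push_cast
      rfl
    rw [h3]
    exact h1.comp_clm _
  have h4 := isCompactOperator_of_pow_two_pow (IsSelfAdjoint.of_nonneg hA) n h2
  refine isCompactOperator_of_star_mul_self ?_
  rw [← CFC.abs_mul_abs]
  exact h4.comp_clm _

/-! ### Singular value decomposition. -/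

theorem norm_abs_apply (x : H →L[ℂ] H) (v : H) : ‖CFC.abs x v‖ = ‖x v‖ := by
  have h1 : ‖CFC.abs x v‖ ^ 2 = ‖x v‖ ^ 2 := by
    have h (y : H →L[ℂ] H) : ((‖y v‖ ^ 2 : ℝ) : ℂ) = ⟪v, (star y * y) v⟫_ℂ := by
      rw [mul_apply_eq_comp, inner_star_right, inner_self_eq_norm_sq_to_K]
      norm_cast
    have := h (CFC.abs x)
    rw [(IsSelfAdjoint.of_nonneg (CFC.abs_nonneg x)).star_eq, CFC.abs_mul_abs, ← h x] at this
    exact_mod_cast this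
  exact (sq_eq_sq₀ (norm_nonneg _) (norm_nonneg _)).1 h1

/-- The divided difference of `t ↦ t^p` at `l` is continuous, since `p ≥ 1` gives differentiability
even at `l = 0`. Hence `a^p - l^p` factors through `a - l`, which kills `v`. -/
theorem rpow_apply_of_eigenvector {a : H →L[ℂ] H} (ha : 0 ≤ a) {p : ℝ} (hp : 1 ≤ p) {l : ℝ}
    {v : H} (hv : a v = (l : ℂ) • v) : (a ^ p) v = ((l ^ p : ℝ) : ℂ) • v := by
  have hsa : IsSelfAdjoint a := .of_nonneg ha
  have hd : ContinuousOn (dslope (fun t : ℝ => t ^ p) l) (spectrum ℝ a) := by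
    refine ContinuousOn.mono (s := Set.univ) ?_ (Set.subset_univ _)
    rw [continuousOn_dslope Filter.univ_mem]
    exact ⟨(Real.continuous_rpow_const (by linarith)).continuousOn,
      (Real.hasDerivAt_rpow_const (Or.inr hp)).differentiableAt⟩
  have h1 : a ^ p = cfc (dslope (fun t : ℝ => t ^ p) l) a * (a - algebraMap ℝ _ l)
      + algebraMap ℝ _ (l ^ p) := by
    have h2 : a - algebraMap ℝ _ l = cfc (fun t : ℝ => t - l) a := by
      rw [cfc_sub .., cfc_id' ℝ a, cfc_const ..]
    rw [h2, CFC.rpow_eq_cfc_real ha, ← cfc_mul .., ← cfc_const (l ^ p) a, ← cfc_add ..]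
    refine cfc_congr fun t _ => ?_
    have := sub_smul_dslope (fun t : ℝ => t ^ p) l t
    simp only [smul_eq_mul] at this
    simp only [mul_comm, this]
    ring
  have h3 : (a - algebraMap ℝ (H →L[ℂ] H) l) v = 0 := by
    simp [hv, Algebra.algebraMap_eq_smul_one]
  rw [h1, add_apply, mul_apply_eq_comp, h3, map_zero, zero_add]
  simp [Algebra.algebraMap_eq_smul_one]

/-- A singular value decomposition `x v = ∑ₖ sₖ ⟪eₖ, v⟫ fₖ` of a bounded operator. -/
structure SingularSystem {κ : Type*} (x : H →L[ℂ] H) (e f : κ → H) (s : κ → ℝ) : Prop where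
  orthonormal_left : Orthonormal ℂ e
  orthonormal_right : Orthonormal ℂ f
  pos : ∀ k, 0 < s k
  apply_left : ∀ k, x (e k) = (s k : ℂ) • f k
  star_apply_right : ∀ k, star x (f k) = (s k : ℂ) • e k
  hasSum : ∀ v, HasSum (fun k => ((s k : ℂ) * ⟪e k, v⟫_ℂ) • f k) (x v)

theorem exists_hilbertBasis_eigenvector {a : H →L[ℂ] H} (ha : IsCompactOperator a)
    (hs : IsSelfAdjoint a) :
    ∃ (κ : Type u) (b : HilbertBasis κ ℂ H), ∀ k, ∃ μ : ℂ, a (b k) = μ • b k := by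
  have hsym : (a : H →ₗ[ℂ] H).IsSymmetric := ContinuousLinearMap.isSelfAdjoint_iff_isSymmetric.1 hs
  let E : ℂ → Submodule ℂ H := Module.End.eigenspace (a : Module.End ℂ H)
  have hcl (μ : ℂ) : CompleteSpace (E μ) := by
    have h1 : E μ = (a - μ • (1 : H →L[ℂ] H)).ker := by
      ext v
      rw [Module.End.mem_eigenspace_iff]
      simp [sub_eq_zero]
    have h2 : IsClosed (E μ : Set H) := by
      rw [h1]
      exact (a - μ • (1 : H →L[ℂ] H)).isClosed_ker
    exact h2.completeSpace_coe
  choose w c hc using fun μ : ℂ => exists_hilbertBasis ℂ (E μ)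
  have ho := hsym.orthogonalFamily_eigenspaces.orthonormal_sigma_orthonormal
    (fun μ => (c μ).orthonormal)
  let v : (Σ μ : ℂ, w μ) → H := fun i => (c i.1 i.2 : E i.1)
  have hov : Orthonormal ℂ v := ho
  have hbot : (Submodule.span ℂ (Set.range v))ᗮ = ⊥ := by
    rw [eq_bot_iff, ← ContinuousLinearMap.orthogonalComplement_iSup_eigenspaces_eq_bot ha hsym]
    intro z hz
    rw [Submodule.mem_orthogonal'] at hz ⊢
    intro y hy
    refine Submodule.iSup_induction _ (motive := fun y => ⟪z, y⟫_ℂ = 0) hy ?_ (by simp) ?_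
    · intro μ y hy
      have h3 := ((c μ).hasSum_repr ⟨y, hy⟩).mapL (E μ).subtypeL
      have h4 := h3.mapL (innerSL ℂ z)
      refine h4.unique ?_
      convert hasSum_zero with i
      have := hz _ (Submodule.subset_span ⟨⟨μ, i⟩, rfl⟩)
      simpa using Or.inr this
    · intro y y' h h'
      rw [inner_add_right, h, h', add_zero]
  refine ⟨_, HilbertBasis.mkOfOrthogonalEqBot hov hbot, fun k => ⟨k.1, ?_⟩⟩
  rw [HilbertBasis.coe_mkOfOrthogonalEqBot]
  exact Module.End.mem_eigenspace_iff.1 (c k.1 k.2).2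

open scoped ComplexOrder in
theorem exists_singularSystem {x : H →L[ℂ] H} (hx : IsCompactOperator x) :
    ∃ (κ : Type u) (e f : κ → H) (s : κ → ℝ), SingularSystem x e f s ∧
      ∀ p : ℝ, 1 ≤ p → trace (CFC.abs x ^ p) = ∑' k, ENNReal.ofReal (s k ^ p) := by
  have hA : 0 ≤ CFC.abs x := CFC.abs_nonneg x
  have hAs : IsSelfAdjoint (CFC.abs x) := .of_nonneg hA
  have hAc : IsCompactOperator (CFC.abs x : H →L[ℂ] H) := by
    refine isCompactOperator_of_star_mul_self ?_
    rw [hAs.star_eq, CFC.abs_mul_abs]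
    exact hx.clm_comp (star x)
  obtain ⟨κ, b, hb⟩ := exists_hilbertBasis_eigenvector hAc hAs
  choose μ hμ using hb
  have hnorm (k : κ) : ⟪b k, b k⟫_ℂ = 1 := by
    rw [inner_self_eq_norm_sq_to_K, b.orthonormal.1 k]
    simp
  have hμ0 (k : κ) : 0 ≤ μ k := by
    have h1 := ((ContinuousLinearMap.nonneg_iff_isPositive _).1 hA).inner_nonneg_right (b k)
    rwa [hμ, inner_smul_right, hnorm, mul_one] at h1
  let l : κ → ℝ := fun k => (μ k).re
  have hl0 (k : κ) : 0 ≤ l k := (Complex.nonneg_iff.1 (hμ0 k)).1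
  have hl (k : κ) : CFC.abs x (b k) = (l k : ℂ) • b k := by
    rw [hμ]
    congr 1
    exact Complex.ext rfl (Complex.nonneg_iff.1 (hμ0 k)).2.symm
  have hxx (k : κ) : star x (x (b k)) = ((l k : ℂ) * l k) • b k := by
    rw [← mul_apply_eq_comp, ← CFC.abs_mul_abs, mul_apply_eq_comp, hl, map_smul, hl, smul_smul]
  have hx0 (k : κ) (hk : l k = 0) : x (b k) = 0 := by
    rw [← norm_eq_zero, ← norm_abs_apply, hl, hk]
    simp
  have hne (k : {k // l k ≠ 0}) : (l k : ℂ) ≠ 0 := by exact_mod_cast k.2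
  -- Only eigenvectors of `|x|` with nonzero eigenvalue are kept; the right vectors are their
  -- normalized images under `x`.
  refine ⟨{k // l k ≠ 0}, fun k => b k, fun k => (l k : ℂ)⁻¹ • x (b k), fun k => l k,
    ⟨b.orthonormal.comp _ Subtype.val_injective, ?_, fun k => (hl0 k).lt_of_ne' k.2, ?_, ?_, ?_⟩,
    ?_⟩
  · classical
    rw [orthonormal_iff_ite]
    intro i j
    rw [inner_smul_left, inner_smul_right, ← inner_star_right, hxx, inner_smul_right,
      orthonormal_iff_ite.1 b.orthonormal]
    by_cases hij : i = j
    · subst hij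
      simp [hne i]
    · simp [hij, Subtype.val_injective.ne hij]
  · intro k
    rw [smul_inv_smul₀ (hne k)]
  · intro k
    rw [map_smul, hxx, smul_smul, inv_mul_cancel_left₀ (hne k)]
  · intro v
    have h1 := (b.hasSum_repr v).mapL x
    rw [← hasSum_subtype_iff_of_support_subset (s := {k | l k ≠ 0})] at h1
    · refine (congrArg (fun F => HasSum F (x v)) (funext fun k => ?_)).mpr h1
      have hk : (l k : ℂ) ≠ 0 := hne k
      simp only [Function.comp_apply, map_smul, HilbertBasis.repr_apply_apply, smul_smul]
      field_simp
    · intro k hk h0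
      exact hk (by simp [hx0 k h0])
  · intro p hp
    rw [trace_eq_tsum b _ CFC.rpow_nonneg, ← tsum_subtype_eq_of_support_subset
      (s := {k | l k ≠ 0})]
    · refine tsum_congr fun k => ?_
      rw [rpow_apply_of_eigenvector hA hp (hl k), inner_smul_right, hnorm, mul_one,
        Complex.ofReal_re]
    · intro k hk h0
      refine hk ?_
      simp [rpow_apply_of_eigenvector hA hp (hl k), h0, Real.zero_rpow (show p ≠ 0 by linarith)]

/-! ### The variational inequality. -/

theorem rpow_tsum_mul_le {κ : Type*} {p : ℝ} (hp : 1 ≤ p) (w a : κ → ℝ≥0∞)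
    (hw : ∑' k, w k ≤ 1) : (∑' k, w k * a k) ^ p ≤ ∑' k, w k * a k ^ p := by
  have hp0 : 0 < p := by linarith
  rw [← ENNReal.le_rpow_inv_iff hp0]
  refine ENNReal.summable.tsum_le_of_sum_le fun s => ?_
  refine (ENNReal.inner_le_weight_mul_Lp_of_nonneg s hp w a).trans ?_
  have h1 : (∑ k ∈ s, w k) ^ (1 - p⁻¹) ≤ 1 :=
    ENNReal.rpow_le_one ((ENNReal.sum_le_tsum s).trans hw) (sub_nonneg.2 (inv_le_one_of_one_le₀ hp))
  calc _ ≤ 1 * (∑ k ∈ s, w k * a k ^ p) ^ p⁻¹ := by gcongr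
    _ ≤ _ := by
      rw [one_mul]
      gcongr
      exact ENNReal.sum_le_tsum s

theorem tsum_enorm_inner_sq_le {κ : Type*} {e : κ → H} (he : Orthonormal ℂ e) (v : H) :
    ∑' k, ‖⟪e k, v⟫_ℂ‖ₑ ^ 2 ≤ ‖v‖ₑ ^ 2 := by
  have h (z : ℂ) : ‖z‖ₑ ^ 2 = ENNReal.ofReal (‖z‖ ^ 2) := by
    rw [ENNReal.ofReal_pow (norm_nonneg _), ofReal_norm]
  simp_rw [h]
  rw [← ENNReal.ofReal_tsum_of_nonneg (fun _ => by positivity) (he.inner_products_summable v),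
    ← ofReal_norm, ← ENNReal.ofReal_pow (norm_nonneg _)]
  exact ENNReal.ofReal_le_ofReal (he.tsum_inner_products_le v)

theorem tsum_mul_le_one {κ : Type*} {a b : κ → ℝ≥0∞} (ha : ∑' k, a k ^ 2 ≤ 1)
    (hb : ∑' k, b k ^ 2 ≤ 1) : ∑' k, a k * b k ≤ 1 := by
  refine ENNReal.summable.tsum_le_of_sum_le fun s => ?_
  have h := ENNReal.inner_le_Lp_mul_Lq s a b Real.HolderConjugate.two_two
  refine h.trans ?_
  have h1 {c : κ → ℝ≥0∞} (hc : ∑' k, c k ^ 2 ≤ 1) : (∑ k ∈ s, c k ^ (2 : ℝ)) ^ (1 / 2 : ℝ) ≤ 1 := by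
    refine ENNReal.rpow_le_one ?_ (by norm_num)
    simpa using (ENNReal.sum_le_tsum s).trans hc
  exact mul_le_one' (h1 ha) (h1 hb)

/-- If the sesquilinear form of `x` is dominated by a diagonal form with entries `s` in
orthonormal systems `e`, `f`, then the `ℓ^p` norm of the diagonal of `x` in any two orthonormal
systems is at most that of `s`. -/
theorem tsum_inner_rpow_le_of_dominated {κ ι : Type*} {p : ℝ} (hp : 1 ≤ p) {x : H →L[ℂ] H}
    {e f : κ → H} (he : Orthonormal ℂ e) (hf : Orthonormal ℂ f) {s : κ → ℝ≥0∞}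
    (hx : ∀ g h, ‖⟪h, x g⟫_ℂ‖ₑ ≤ ∑' k, ‖⟪e k, g⟫_ℂ‖ₑ * ‖⟪f k, h⟫_ℂ‖ₑ * s k)
    {g h : ι → H} (hg : Orthonormal ℂ g) (hh : Orthonormal ℂ h) :
    ∑' j, ‖⟪h j, x (g j)⟫_ℂ‖ₑ ^ p ≤ ∑' k, s k ^ p := by
  have h1 {v : H} (hv : ‖v‖ = 1) : ‖v‖ₑ ^ 2 = 1 := by
    rw [← ofReal_norm, hv]
    simp
  calc ∑' j, ‖⟪h j, x (g j)⟫_ℂ‖ₑ ^ p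
      ≤ ∑' j, (∑' k, ‖⟪e k, g j⟫_ℂ‖ₑ * ‖⟪f k, h j⟫_ℂ‖ₑ * s k) ^ p := by
        gcongr with j
        exact hx _ _
    -- Jensen's inequality: by Bessel and Cauchy–Schwarz the weights `|⟪e k, g j⟫| |⟪f k, h j⟫|`
    -- have row sums at most 1. The column sums, bounded likewise, finish the estimate below.
    _ ≤ ∑' j, ∑' k, ‖⟪e k, g j⟫_ℂ‖ₑ * ‖⟪f k, h j⟫_ℂ‖ₑ * s k ^ p := by
        gcongr with j
        refine rpow_tsum_mul_le hp _ _ (tsum_mul_le_one ?_ ?_)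
        · exact (tsum_enorm_inner_sq_le he _).trans_eq (h1 (hg.1 j))
        · exact (tsum_enorm_inner_sq_le hf _).trans_eq (h1 (hh.1 j))
    _ = ∑' k, (∑' j, ‖⟪g j, e k⟫_ℂ‖ₑ * ‖⟪h j, f k⟫_ℂ‖ₑ) * s k ^ p := by
        rw [ENNReal.tsum_comm]
        refine tsum_congr fun k => ?_
        rw [← ENNReal.tsum_mul_right]
        refine tsum_congr fun j => ?_
        simp only [← ofReal_norm, norm_inner_symm (e k), norm_inner_symm (f k)]
    _ ≤ ∑' k, 1 * s k ^ p := by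
        gcongr with k
        refine tsum_mul_le_one ?_ ?_
        · exact (tsum_enorm_inner_sq_le hg _).trans_eq (h1 (he.1 k))
        · exact (tsum_enorm_inner_sq_le hh _).trans_eq (h1 (hf.1 k))
    _ = _ := by simp

namespace SingularSystem

variable {κ : Type*} {x : H →L[ℂ] H} {e f : κ → H} {s : κ → ℝ}

theorem enorm_inner_le (hs : SingularSystem x e f s) (g h : H) :
    ‖⟪h, x g⟫_ℂ‖ₑ ≤ ∑' k, ‖⟪e k, g⟫_ℂ‖ₑ * ‖⟪f k, h⟫_ℂ‖ₑ * ENNReal.ofReal (s k) := by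
  have h1 := (hs.hasSum g).mapL (innerSL ℂ h)
  refine h1.enorm_le_of_bounded ENNReal.summable.hasSum fun k => le_of_eq ?_
  simp only [innerSL_apply_apply, inner_smul_right, enorm_mul]
  rw [← ofReal_norm ⟪h, f k⟫_ℂ, norm_inner_symm, ofReal_norm, ← ofReal_norm (s k : ℂ),
    Complex.norm_real, Real.norm_of_nonneg (hs.pos k).le]
  ring

theorem inner_apply (hs : SingularSystem x e f s) (k : κ) : ⟪f k, x (e k)⟫_ℂ = s k := by
  rw [hs.apply_left, inner_smul_right, inner_self_eq_norm_sq_to_K, hs.orthonormal_right.1 k]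
  simp

theorem left_eq (hs : SingularSystem x e f s) (k : κ) : e k = star x ((s k : ℂ)⁻¹ • f k) := by
  rw [map_smul, hs.star_apply_right, inv_smul_smul₀ (by exact_mod_cast (hs.pos k).ne')]

theorem right_eq (hs : SingularSystem x e f s) (k : κ) : f k = x ((s k : ℂ)⁻¹ • e k) := by
  rw [map_smul, hs.apply_left, inv_smul_smul₀ (by exact_mod_cast (hs.pos k).ne')]

end SingularSystem

/-! ### Schatten norms and the linear structure of the Schatten space. -/

/-- The `p`-th power `tr |x|^p` of the Schatten norm. -/
noncomputable def traceAbsRpow (p : ℝ) (x : H →L[ℂ] H) : ℝ≥0∞ :=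
  trace (CFC.abs x ^ p)

theorem mem_schatten_iff {p : ℝ} {x : H →L[ℂ] H} : x ∈ schatten H p ↔ traceAbsRpow p x < ∞ :=
  Iff.rfl

theorem schattenNorm_rpow {p : ℝ} (hp : 1 ≤ p) (x : H →L[ℂ] H) :
    schattenNorm p x ^ p = traceAbsRpow p x := by
  rw [schattenNorm, traceAbsRpow, ← ENNReal.rpow_mul, one_div_mul_cancel (by linarith),
    ENNReal.rpow_one]

theorem schattenNorm_le_iff {p : ℝ} (hp : 1 ≤ p) (x y : H →L[ℂ] H) :
    schattenNorm p x ≤ schattenNorm p y ↔ traceAbsRpow p x ≤ traceAbsRpow p y := by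
  rw [← schattenNorm_rpow hp, ← schattenNorm_rpow hp, ENNReal.rpow_le_rpow_iff (by linarith)]

theorem tsum_inner_rpow_le {p : ℝ} (hp : 1 ≤ p) (x : H →L[ℂ] H) {ι : Type*} {g h : ι → H}
    (hg : Orthonormal ℂ g) (hh : Orthonormal ℂ h) :
    ∑' j, ‖⟪h j, x (g j)⟫_ℂ‖ₑ ^ p ≤ traceAbsRpow p x := by
  by_cases hx : x ∈ schatten H p
  · obtain ⟨κ, e, f, s, hs, ht⟩ := exists_singularSystem
      (isCompactOperator_of_mem_schatten (by linarith) hx)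
    refine (tsum_inner_rpow_le_of_dominated hp hs.orthonormal_left hs.orthonormal_right
      hs.enorm_inner_le hg hh).trans_eq ?_
    rw [traceAbsRpow, ht p hp]
    exact tsum_congr fun k => ENNReal.ofReal_rpow_of_pos (hs.pos k)
  · rw [mem_schatten_iff, not_lt, top_le_iff] at hx
    rw [hx]
    exact le_top

theorem SingularSystem.traceAbsRpow_eq {p : ℝ} {x : H →L[ℂ] H} {κ : Type*} {e f : κ → H}
    {s : κ → ℝ} (hs : SingularSystem x e f s)
    (ht : trace (CFC.abs x ^ p) = ∑' k, ENNReal.ofReal (s k ^ p)) :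
    traceAbsRpow p x = ∑' k, ‖⟪f k, x (e k)⟫_ℂ‖ₑ ^ p := by
  rw [traceAbsRpow, ht]
  refine tsum_congr fun k => ?_
  rw [hs.inner_apply, ← ofReal_norm, Complex.norm_real, Real.norm_of_nonneg (hs.pos k).le,
    ENNReal.ofReal_rpow_of_pos (hs.pos k)]

theorem exists_singularSystem_traceAbsRpow_eq {p : ℝ} (hp : 1 ≤ p) {x : H →L[ℂ] H}
    (hx : IsCompactOperator x) :
    ∃ (κ : Type u) (e f : κ → H) (s : κ → ℝ), SingularSystem x e f s ∧
      traceAbsRpow p x = ∑' k, ‖⟪f k, x (e k)⟫_ℂ‖ₑ ^ p := by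
  obtain ⟨κ, e, f, s, hs, ht⟩ := exists_singularSystem hx
  exact ⟨κ, e, f, s, hs, hs.traceAbsRpow_eq (ht p hp)⟩

theorem enorm_inner_rpow_le {p : ℝ} (hp : 1 ≤ p) (x : H →L[ℂ] H) {v w : H} (hv : ‖v‖ = 1)
    (hw : ‖w‖ = 1) : ‖⟪w, x v⟫_ℂ‖ₑ ^ p ≤ traceAbsRpow p x := by
  have h (z : H) (hz : ‖z‖ = 1) : Orthonormal ℂ (fun _ : Unit => z) :=
    ⟨fun _ => hz, fun i j hij => (hij (Subsingleton.elim i j)).elim⟩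
  simpa using tsum_inner_rpow_le hp x (h v hv) (h w hw)

theorem enorm_le_schattenNorm {p : ℝ} (hp : 1 ≤ p) (x : H →L[ℂ] H) :
    ‖x‖ₑ ≤ schattenNorm p x := by
  have hp0 : 0 < p := by linarith
  by_cases hx : schattenNorm p x = ∞
  · rw [hx]
    exact le_top
  have key {v w : H} (hv : ‖v‖ = 1) (hw : ‖w‖ = 1) :
      ‖⟪w, x v⟫_ℂ‖ ≤ (schattenNorm p x).toReal := by
    have h1 := enorm_inner_rpow_le hp x hv hw
    rw [← schattenNorm_rpow hp, ENNReal.rpow_le_rpow_iff hp0] at h1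
    have h2 := ENNReal.toReal_mono hx h1
    rwa [toReal_enorm] at h2
  rw [← ofReal_norm, ← ENNReal.ofReal_toReal hx]
  refine ENNReal.ofReal_le_ofReal ?_
  refine ContinuousLinearMap.opNorm_le_of_re_inner_le ENNReal.toReal_nonneg fun v w hv hw => ?_
  refine (Complex.re_le_norm _).trans ?_
  rw [norm_inner_symm]
  exact key hv hw

theorem isCompactOperator_star {x : H →L[ℂ] H} (hx : IsCompactOperator x) :
    IsCompactOperator (star x : H →L[ℂ] H) := by
  refine isCompactOperator_of_star_mul_self ?_
  rw [star_star]
  exact hx.comp_clm (star x)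

theorem star_mem_schatten {p : ℝ} (hp : 1 ≤ p) {x : H →L[ℂ] H} (hx : x ∈ schatten H p) :
    star x ∈ schatten H p := by
  have hc := isCompactOperator_of_mem_schatten (by linarith) hx
  obtain ⟨κ, e, f, s, hs, ht⟩ :=
    exists_singularSystem_traceAbsRpow_eq hp (isCompactOperator_star hc)
  rw [mem_schatten_iff, ht]
  refine lt_of_le_of_lt ?_ (mem_schatten_iff.1 hx)
  refine le_trans (le_of_eq (tsum_congr fun k => ?_))
    (tsum_inner_rpow_le hp x hs.orthonormal_right hs.orthonormal_left)
  rw [inner_star_right, ← ofReal_norm, norm_inner_symm, ofReal_norm]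

variable (H) in
/-- The Schatten space `S^p(H)` as a subspace of the bounded operators. -/
noncomputable def schattenSubmodule (p : ℝ) (hp : 1 ≤ p) : Submodule ℂ (H →L[ℂ] H) where
  carrier := schatten H p
  zero_mem' := by
    have h : trace (0 : H →L[ℂ] H) = 0 := by simp [trace]
    have h2 : (0 : H →L[ℂ] H) ^ p = 0 := CFC.zero_rpow (by linarith)
    simp [schatten, h2, h]
  add_mem' := by
    intro x y hx hy
    obtain ⟨κ, e, f, s, hs, ht⟩ := exists_singularSystem_traceAbsRpow_eq hp
      (show IsCompactOperator (x + y : H →L[ℂ] H) from (isCompactOperator_of_mem_schatten (by linarith) hx).add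
        (isCompactOperator_of_mem_schatten (by linarith) hy))
    -- Only finiteness matters, so convexity of `t ↦ t^p` on the singular systems of `x + y`
    -- replaces the sharp triangle inequality.
    have h : traceAbsRpow p (x + y) ≤
        2 ^ (p - 1) * (traceAbsRpow p x + traceAbsRpow p y) := by
      rw [ht]
      calc _ ≤ ∑' k, 2 ^ (p - 1) * (‖⟪f k, x (e k)⟫_ℂ‖ₑ ^ p + ‖⟪f k, y (e k)⟫_ℂ‖ₑ ^ p) := by
            gcongr with k
            refine le_trans ?_ (ENNReal.rpow_add_le_mul_rpow_add_rpow _ _ hp)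
            rw [add_apply, inner_add_right]
            exact ENNReal.rpow_le_rpow (enorm_add_le _ _) (by linarith)
        _ ≤ _ := by
            rw [ENNReal.tsum_mul_left, ENNReal.tsum_add]
            gcongr
            · exact tsum_inner_rpow_le hp x hs.orthonormal_left hs.orthonormal_right
            · exact tsum_inner_rpow_le hp y hs.orthonormal_left hs.orthonormal_right
    exact h.trans_lt (ENNReal.mul_lt_top (ENNReal.rpow_lt_top_of_nonneg (by linarith) (by simp))
      (ENNReal.add_lt_top.2 ⟨hx, hy⟩))
  smul_mem' := by
    intro c x hx
    obtain ⟨κ, e, f, s, hs, ht⟩ := exists_singularSystem_traceAbsRpow_eq hp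
      (show IsCompactOperator (c • x : H →L[ℂ] H) from (isCompactOperator_of_mem_schatten (by linarith) hx).smul c)
    have h : traceAbsRpow p (c • x) ≤ ‖c‖ₑ ^ p * traceAbsRpow p x := by
      rw [ht]
      calc _ = ∑' k, ‖c‖ₑ ^ p * ‖⟪f k, x (e k)⟫_ℂ‖ₑ ^ p := by
            refine tsum_congr fun k => ?_
            rw [smul_apply, inner_smul_right, enorm_mul, ENNReal.mul_rpow_of_nonneg _ _
              (by linarith)]
        _ ≤ _ := by
            rw [ENNReal.tsum_mul_left]
            gcongr
            exact tsum_inner_rpow_le hp x hs.orthonormal_left hs.orthonormal_right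
    exact h.trans_lt (ENNReal.mul_lt_top (ENNReal.rpow_lt_top_of_nonneg (by linarith) (by simp))
      hx)

/-! ### Disjoint sums and block compressions. -/

theorem orthonormal_sigma {ι : Type*} {κ : ι → Type*} {e : ∀ i, κ i → H}
    (h : ∀ i, Orthonormal ℂ (e i)) (h' : ∀ i j, i ≠ j → ∀ k l, ⟪e i k, e j l⟫_ℂ = 0) :
    Orthonormal ℂ (fun k : Σ i, κ i => e k.1 k.2) := by
  refine ⟨fun k => (h k.1).1 k.2, ?_⟩
  rintro ⟨i, k⟩ ⟨j, l⟩ hne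
  by_cases hij : i = j
  · subst hij
    exact (h i).2 fun hkl => hne (congrArg (Sigma.mk i) hkl)
  · exact h' i j hij k l

theorem isCompactOperator_of_hasSum {ι : Type*} {y : ι → H →L[ℂ] H} {z : H →L[ℂ] H}
    (hz : HasSum y z) (hy : ∀ i, IsCompactOperator (y i)) : IsCompactOperator z :=
  isCompactOperator_of_tendsto hz (.of_forall fun F =>
    isCompactOperator_finset_sum F y fun i _ => hy i)

/-- Disjointness makes the singular vectors of different `y i` orthogonal on both sides. Together
they form orthonormal systems that dominate the form of `z`. -/
theorem traceAbsRpow_le_tsum_of_disjoint {p : ℝ} (hp : 1 ≤ p) {ι : Type*} {y : ι → H →L[ℂ] H}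
    {z : H →L[ℂ] H} (hz : HasSum y z) (hy : ∀ i, y i ∈ schatten H p)
    (hd : Pairwise fun i j => Disjoint (y i) (y j)) :
    traceAbsRpow p z ≤ ∑' i, traceAbsRpow p (y i) := by
  have hc (i : ι) := isCompactOperator_of_mem_schatten (by linarith) (hy i)
  choose κ e f s hs ht using fun i => exists_singularSystem (hc i)
  obtain ⟨κ', e', f', s', hs', ht'⟩ := exists_singularSystem_traceAbsRpow_eq hp
    (isCompactOperator_of_hasSum hz hc)
  rw [ht']
  have he := orthonormal_sigma (fun i => (hs i).orthonormal_left) fun i j hij k l => by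
    rw [(hs i).left_eq, (hs j).left_eq, inner_star_left, ← mul_apply_eq_comp, (hd hij).2]
    simp
  have hf := orthonormal_sigma (fun i => (hs i).orthonormal_right) fun i j hij k l => by
    rw [(hs i).right_eq, (hs j).right_eq, ← inner_star_right, ← mul_apply_eq_comp, (hd hij).1]
    simp
  refine (tsum_inner_rpow_le_of_dominated hp he hf (s := fun k => ENNReal.ofReal (s k.1 k.2))
    (fun g h => ?_) hs'.orthonormal_left hs'.orthonormal_right).trans_eq ?_
  · rw [ENNReal.tsum_sigma']
    have h1 := (hz.mapL (ContinuousLinearMap.apply ℂ H g)).mapL (innerSL ℂ h)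
    exact h1.enorm_le_of_bounded ENNReal.summable.hasSum fun i => (hs i).enorm_inner_le g h
  · rw [ENNReal.tsum_sigma']
    refine tsum_congr fun i => ?_
    rw [traceAbsRpow, ht i p hp]
    exact tsum_congr fun k => ENNReal.ofReal_rpow_of_pos ((hs i).pos k)

theorem traceAbsRpow_le_of_disjoint {p : ℝ} (hp : 1 ≤ p) {a b : H →L[ℂ] H}
    (ha : a ∈ schatten H p) (hd : Disjoint a b) : traceAbsRpow p a ≤ traceAbsRpow p (a + b) := by
  obtain ⟨κ, e, f, s, hs, ht⟩ := exists_singularSystem_traceAbsRpow_eq hp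
    (isCompactOperator_of_mem_schatten (by linarith) ha)
  rw [ht]
  refine le_trans (le_of_eq (tsum_congr fun k => ?_))
    (tsum_inner_rpow_le hp (a + b) hs.orthonormal_left hs.orthonormal_right)
  have h0 : ⟪f k, b (e k)⟫_ℂ = 0 := by
    rw [hs.right_eq, ← inner_star_right, ← mul_apply_eq_comp, hd.1]
    simp
  rw [add_apply, inner_add_right, h0, add_zero]

/-- The singular vectors of `q i * x * q i` lie in the range of `q i`. Hence they are orthogonal
across blocks, and `q i` drops out of their pairings with `x`. -/
theorem tsum_traceAbsRpow_compress_le {p : ℝ} (hp : 1 ≤ p) {ι : Type*} {q : ι → H →L[ℂ] H}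
    (hq : ∀ i, IsStarProjection (q i)) (hqq : ∀ i j, i ≠ j → q i * q j = 0)
    {x : H →L[ℂ] H} (hx : x ∈ schatten H p) :
    ∑' i, traceAbsRpow p (q i * x * q i) ≤ traceAbsRpow p x := by
  have hxc := isCompactOperator_of_mem_schatten (by linarith) hx
  have hc (i : ι) : IsCompactOperator (q i * x * q i : H →L[ℂ] H) :=
    (hxc.clm_comp (q i)).comp_clm (q i)
  choose κ e f s hs ht using fun i => exists_singularSystem_traceAbsRpow_eq hp (hc i)
  have hsa (i : ι) : star (q i) = q i := (hq i).isSelfAdjoint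
  have hqe (i : ι) (k : κ i) : q i (e i k) = e i k := by
    rw [(hs i).left_eq, ← mul_apply_eq_comp]
    congr 1
    simp only [star_mul, hsa, ← mul_assoc, (hq i).isIdempotentElem.eq]
  have hqf (i : ι) (k : κ i) : q i (f i k) = f i k := by
    rw [(hs i).right_eq, ← mul_apply_eq_comp]
    congr 1
    simp only [← mul_assoc, (hq i).isIdempotentElem.eq]
  have horth {i j : ι} (hij : i ≠ j) {v w : H} (hv : q i v = v) (hw : q j w = w) :
      ⟪v, w⟫_ℂ = 0 := by
    rw [← hv, ← hw, ← inner_star_right, hsa, ← mul_apply_eq_comp, hqq i j hij]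
    simp
  have he := orthonormal_sigma (fun i => (hs i).orthonormal_left) fun i j hij k l =>
    horth hij (hqe i k) (hqe j l)
  have hf := orthonormal_sigma (fun i => (hs i).orthonormal_right) fun i j hij k l =>
    horth hij (hqf i k) (hqf j l)
  refine le_trans (le_of_eq ?_) (tsum_inner_rpow_le hp x he hf)
  rw [ENNReal.tsum_sigma']
  refine tsum_congr fun i => ?_
  rw [ht]
  refine tsum_congr fun k => ?_
  rw [mul_apply_eq_comp, mul_apply_eq_comp, hqe, ← hsa, inner_star_right, hqf]

/-- Disjointness gives `(a + b)² = (|a| + |b|)²` for the self-adjoint `a + b`, so uniqueness of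
positive square roots yields `a + b = |a| + |b|`; separating the supports gives `a = |a|`. -/
theorem nonneg_of_disjoint_of_add_nonneg {a b : H →L[ℂ] H} (hd : Disjoint a b)
    (h : 0 ≤ a + b) : 0 ≤ a := by
  obtain ⟨hab, hab'⟩ := hd
  have hba : star b * a = 0 := by simpa using congrArg star hab
  have hba' : b * star a = 0 := by simpa using congrArg star hab'
  set A := CFC.abs a with hA
  set B := CFC.abs b with hB
  have hA0 : 0 ≤ A := CFC.abs_nonneg a
  have hB0 : 0 ≤ B := CFC.abs_nonneg b
  have hAs : star A = A := IsSelfAdjoint.of_nonneg hA0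
  have hBs : star B = B := IsSelfAdjoint.of_nonneg hB0
  have hAA : A * A = star a * a := CFC.abs_mul_abs a
  have hBB : B * B = star b * b := CFC.abs_mul_abs b
  have hxs : star (a + b) = a + b := IsSelfAdjoint.of_nonneg h
  have cancel {c : H →L[ℂ] H} (hc : c * (A * A) = 0) : c * A = 0 := by
    rw [← CStarRing.mul_star_self_eq_zero_iff, star_mul, hAs, ← mul_assoc, mul_assoc c, hc,
      zero_mul]
  have hbA : b * A = 0 := cancel (by rw [hAA, ← mul_assoc, hba', zero_mul])
  have hBA : B * A = 0 := by
    rw [← CStarRing.star_mul_self_eq_zero_iff, star_mul, hBs, hAs, mul_assoc, ← mul_assoc B, hBB,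
      mul_assoc (star b), hbA, mul_zero, mul_zero]
  have hAB : A * B = 0 := by simpa [hAs, hBs] using congrArg star hBA
  have hx : a + b = A + B := by
    refine (CFC.mul_self_eq_mul_self_iff _ _ h (add_nonneg hA0 hB0)).1 ?_
    nth_rewrite 1 [← hxs]
    simp only [star_add, add_mul, mul_add, hab, hba, hAB, hBA, hAA, hBB]
  have haA : (a - A) * A = 0 := by
    have := congrArg (· * A) hx
    simp only [add_mul, hbA, hBA, add_zero] at this
    rw [sub_mul, this, sub_self]
  have haa : (a - A) * star a = 0 := by
    have h1 : (a - A) * (star a * a) = 0 := by rw [← hAA, ← mul_assoc, haA, zero_mul]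
    rw [← CStarRing.mul_star_self_eq_zero_iff, star_mul, star_star, ← mul_assoc,
      mul_assoc (a - A), h1, zero_mul]
  -- `a - A` annihilates both `star a` and `A` from the left, hence also its own adjoint.
  have : a = A := by
    rw [← sub_eq_zero, ← CStarRing.mul_star_self_eq_zero_iff, star_sub, hAs, mul_sub, haa, haA,
      sub_zero]
  rw [this]
  exact hA0

/-! ### Uniqueness and convergence of disjoint series. -/

theorem star_mul_eq_of_hasSum {ι : Type*} {f : ι → H →L[ℂ] H} {x : H →L[ℂ] H} (hf : HasSum f x)
    (hd : Pairwise fun i j => Disjoint (f i) (f j)) (i : ι) :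
    star (f i) * x = star (f i) * f i :=
  (hf.mul_left (star (f i))).unique (hasSum_single i fun _ hj => (hd hj.symm).1)

theorem mul_star_eq_of_hasSum {ι : Type*} {f : ι → H →L[ℂ] H} {x : H →L[ℂ] H} (hf : HasSum f x)
    (hd : Pairwise fun i j => Disjoint (f i) (f j)) (i : ι) :
    f i * star x = f i * star (f i) :=
  (hf.star.mul_left (f i)).unique (hasSum_single i fun _ hj => (hd hj.symm).2)

theorem disjoint_sub_of_hasSum {ι : Type*} {f : ι → H →L[ℂ] H} {x : H →L[ℂ] H} (hf : HasSum f x)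
    (hd : Pairwise fun i j => Disjoint (f i) (f j)) (i : ι) : Disjoint (f i) (x - f i) :=
  ⟨by rw [mul_sub, star_mul_eq_of_hasSum hf hd, sub_self],
    by rw [star_sub, mul_sub, mul_star_eq_of_hasSum hf hd, sub_self]⟩

/-- The differences `f i - g i` are pairwise disjoint with sum zero; multiplying by an adjoint
isolates one term, and the C⋆-identity kills it. -/
theorem eq_of_hasSum_of_hasSum {ι : Type*} {Y : ι → Submodule ℂ (H →L[ℂ] H)}
    (hY : Pairwise fun i j => OperatorDisjoint (Y i) (Y j)) {f g : ι → H →L[ℂ] H}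
    {x : H →L[ℂ] H} (hf : HasSum f x) (hg : HasSum g x) (hfY : ∀ i, f i ∈ Y i)
    (hgY : ∀ i, g i ∈ Y i) (i : ι) : f i = g i := by
  have h := star_mul_eq_of_hasSum (hf.sub hg)
    (fun j k hjk => hY hjk _ (sub_mem (hfY j) (hgY j)) _ (sub_mem (hfY k) (hgY k))) i
  rw [sub_self, mul_zero, eq_comm, CStarRing.star_mul_self_eq_zero_iff] at h
  exact sub_eq_zero.1 h

theorem HasSchattenSum.hasSum {ι : Type*} {p : ℝ} (hp : 1 ≤ p) {f : ι → H →L[ℂ] H}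
    {x : H →L[ℂ] H} (h : HasSchattenSum p f x) : HasSum f x := by
  refine tendsto_iff_edist_tendsto_0.2 (tendsto_of_tendsto_of_tendsto_of_le_of_le
    tendsto_const_nhds h (fun _ => zero_le) fun F => ?_)
  rw [edist_comm, edist_eq_enorm_sub]
  exact enorm_le_schattenNorm hp _

theorem summable_of_disjoint {ι : Type*} {p : ℝ} (hp : 1 ≤ p) {f : ι → H →L[ℂ] H}
    (hf : ∀ i, f i ∈ schatten H p) (hd : Pairwise fun i j => Disjoint (f i) (f j))
    (hs : ∑' i, traceAbsRpow p (f i) ≠ ∞) : Summable f := by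
  have hp0 : 0 < p := by linarith
  rw [summable_iff_vanishing_norm]
  intro ε hε
  have h1 : ∀ᶠ s : Finset ι in Filter.atTop,
      ∑' i : {i // i ∉ s}, traceAbsRpow p (f i) < ENNReal.ofReal ε ^ p :=
    (ENNReal.tendsto_tsum_compl_atTop_zero hs).eventually_lt_const
      (ENNReal.rpow_pos (ENNReal.ofReal_pos.2 hε) ENNReal.ofReal_ne_top)
  obtain ⟨s, hs'⟩ := h1.exists
  refine ⟨s, fun t ht => ?_⟩
  have h2 : traceAbsRpow p (∑ i ∈ t, f i) ≤ ∑' i : t, traceAbsRpow p (f i) :=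
    traceAbsRpow_le_tsum_of_disjoint hp (t.hasSum f) (fun i => hf i)
      fun i j hij => hd (Subtype.val_injective.ne hij)
  have h3 : ∑' i : t, traceAbsRpow p (f i) ≤ ∑' i : {i // i ∉ s}, traceAbsRpow p (f i) :=
    ENNReal.tsum_mono_subtype (fun i => traceAbsRpow p (f i)) (s := ↑t) (t := {i | i ∉ s})
      fun i hi => Finset.disjoint_left.1 ht hi
  have h4 := (enorm_le_schattenNorm hp (∑ i ∈ t, f i))
  rw [← ENNReal.rpow_le_rpow_iff hp0, schattenNorm_rpow hp] at h4
  have h5 := ((h4.trans h2).trans h3).trans_lt hs'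
  rw [ENNReal.rpow_lt_rpow_iff hp0, ← ofReal_norm] at h5
  exact (ENNReal.ofReal_lt_ofReal_iff hε).1 h5

theorem hasSchattenSum_of_disjoint {ι : Type*} {p : ℝ} (hp : 1 ≤ p) {f : ι → H →L[ℂ] H}
    {x : H →L[ℂ] H} (hx : HasSum f x) (hf : ∀ i, f i ∈ schatten H p)
    (hd : Pairwise fun i j => Disjoint (f i) (f j)) (hs : ∑' i, traceAbsRpow p (f i) ≠ ∞) :
    HasSchattenSum p f x := by
  have hp0 : 0 < 1 / p := by positivity
  have h0 := ((ENNReal.continuous_rpow_const (y := 1 / p)).tendsto 0).comp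
    (ENNReal.tendsto_tsum_compl_atTop_zero hs)
  rw [ENNReal.zero_rpow_of_pos hp0] at h0
  refine tendsto_of_tendsto_of_tendsto_of_le_of_le tendsto_const_nhds h0 (fun _ => zero_le)
    fun F => ENNReal.rpow_le_rpow ?_ hp0.le
  exact traceAbsRpow_le_tsum_of_disjoint hp ((F.hasSum_compl_iff).2 (by simpa using hx))
    (fun i => hf i) fun i j hij => hd (Subtype.val_injective.ne hij)

/-! ### Positive projections and adjoints. -/

namespace IsPositiveContractiveProjection

variable {p : ℝ} {P : (H →L[ℂ] H) → (H →L[ℂ] H)}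

theorem map_sub (hP : IsPositiveContractiveProjection p P) (hp : 1 ≤ p) {x y : H →L[ℂ] H}
    (hx : x ∈ schatten H p) (hy : y ∈ schatten H p) : P (x - y) = P x - P y := by
  have h1 : x - y = x + (-1 : ℂ) • y := by simp [sub_eq_add_neg]
  rw [h1, hP.map_add _ hx _ ((schattenSubmodule H p hp).smul_mem _ hy), hP.map_smul _ _ hy]
  simp [sub_eq_add_neg]

theorem isSelfAdjoint_map (hP : IsPositiveContractiveProjection p P) (hp : 1 ≤ p)
    {x : H →L[ℂ] H} (hx : x ∈ schatten H p) (hs : IsSelfAdjoint x) : IsSelfAdjoint (P x) := by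
  have ha : CFC.abs x ∈ schatten H p := by
    change trace (CFC.abs (CFC.abs x) ^ p) < ∞
    rwa [CFC.cfcAbs_cfcAbs]
  have hb : CFC.abs x - x ∈ schatten H p := (schattenSubmodule H p hp).sub_mem ha hx
  have hb0 : 0 ≤ CFC.abs x - x := by
    rw [CFC.abs_sub_self x hs]
    exact nsmul_nonneg (CFC.negPart_nonneg x) 2
  -- Both terms are positive and in the Schatten space, as `|x| - x` is twice the negative part.
  have h1 : x = CFC.abs x - (CFC.abs x - x) := by abel
  rw [h1, hP.map_sub hp ha hb]
  have hpos {y : H →L[ℂ] H} (hy : y ∈ schatten H p) (hy0 : 0 ≤ y) : IsSelfAdjoint (P y) :=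
    (hP.positive y hy ((ContinuousLinearMap.nonneg_iff_isPositive y).1 hy0)).isSelfAdjoint
  exact (hpos ha (CFC.abs_nonneg x)).sub (hpos hb hb0)

theorem map_star (hP : IsPositiveContractiveProjection p P) (hp : 1 ≤ p)
    {x : H →L[ℂ] H} (hx : x ∈ schatten H p) : P (star x) = star (P x) := by
  let S := schattenSubmodule H p hp
  obtain ⟨a, b, ha, hb, has, hbs, rfl⟩ : ∃ a b : H →L[ℂ] H, a ∈ schatten H p ∧
      b ∈ schatten H p ∧ IsSelfAdjoint a ∧ IsSelfAdjoint b ∧ x = a + Complex.I • b := by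
    have hsx : star x ∈ S := star_mem_schatten hp hx
    have hx' : x ∈ S := hx
    refine ⟨realPart x, imaginaryPart x, ?_, ?_, (realPart x).2, (imaginaryPart x).2,
      (realPart_add_I_smul_imaginaryPart x).symm⟩
    · change _ ∈ S
      rw [realPart_apply_coe]
      exact S.smul_of_tower_mem _ (S.add_mem hx' hsx)
    · change _ ∈ S
      rw [imaginaryPart_apply_coe]
      exact S.smul_mem _ (S.smul_of_tower_mem _ (S.sub_mem hx' hsx))
  have hP1 (c : ℂ) : P (a + c • b) = P a + c • P b := by
    rw [hP.map_add _ ha _ (S.smul_mem _ hb), hP.map_smul _ _ hb]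
  rw [star_add, star_smul, has.star_eq, hbs.star_eq, hP1, hP1, star_add, star_smul,
    (hP.isSelfAdjoint_map hp ha has).star_eq, (hP.isSelfAdjoint_map hp hb hbs).star_eq]

theorem apply_eq_of_mem (hP : IsPositiveContractiveProjection p P)
    {Y : Submodule ℂ (H →L[ℂ] H)} (hY : P '' schatten H p = (Y : Set (H →L[ℂ] H)))
    {y : H →L[ℂ] H} (hy : y ∈ Y) : P y = y := by
  rw [← SetLike.mem_coe, ← hY] at hy
  obtain ⟨z, hz, rfl⟩ := hy
  exact hP.idempotent z hz

end IsPositiveContractiveProjection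

/-! ### Range projections. -/

/-- The closed linear span of the ranges of the operators in `Y`. -/
noncomputable def rangeClosure (Y : Submodule ℂ (H →L[ℂ] H)) : Submodule ℂ H :=
  (Submodule.span ℂ {w | ∃ y ∈ Y, ∃ v, y v = w}).topologicalClosure

instance (Y : Submodule ℂ (H →L[ℂ] H)) : CompleteSpace (rangeClosure Y) :=
  (Submodule.isClosed_topologicalClosure _).completeSpace_coe

/-- The orthogonal projection onto the closed linear span of the ranges of the operators
in `Y`. -/
noncomputable def rangeProj (Y : Submodule ℂ (H →L[ℂ] H)) : H →L[ℂ] H :=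
  (rangeClosure Y).starProjection

theorem isStarProjection_rangeProj (Y : Submodule ℂ (H →L[ℂ] H)) :
    IsStarProjection (rangeProj Y) :=
  isStarProjection_starProjection

theorem rangeProj_mul {Y : Submodule ℂ (H →L[ℂ] H)} {y : H →L[ℂ] H} (hy : y ∈ Y) :
    rangeProj Y * y = y := by
  ext v
  exact Submodule.starProjection_eq_self_iff.2 (Submodule.le_topologicalClosure _
    (Submodule.subset_span ⟨y, hy, v, rfl⟩))

theorem mul_rangeProj {Y : Submodule ℂ (H →L[ℂ] H)} {y : H →L[ℂ] H} (hy : star y ∈ Y) :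
    y * rangeProj Y = y := by
  have h := congrArg star (rangeProj_mul hy)
  rwa [star_mul, star_star, (isStarProjection_rangeProj Y).isSelfAdjoint.star_eq] at h

theorem rangeProj_mul_rangeProj {Y Z : Submodule ℂ (H →L[ℂ] H)} (h : OperatorDisjoint Y Z) :
    rangeProj Y * rangeProj Z = 0 := by
  refine (Submodule.starProjection_comp_starProjection_eq_zero_iff).2 ?_
  rw [Submodule.IsOrtho, rangeClosure, rangeClosure, Submodule.orthogonal_closure]
  refine Submodule.topologicalClosure_minimal _ ?_ (Submodule.isClosed_orthogonal _)
  change Submodule.IsOrtho _ _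
  rw [Submodule.isOrtho_span]
  rintro _ ⟨y, hy, v, rfl⟩ _ ⟨z, hz, w, rfl⟩
  rw [← inner_star_right, ← mul_apply_eq_comp, (h y hy z hz).1]
  simp

/-! ### The two implications. -/

namespace IsPDirectSum

variable {ι : Type*} {p : ℝ} {X : Submodule ℂ (H →L[ℂ] H)} {Y : ι → Submodule ℂ (H →L[ℂ] H)}

theorem exists_hasSum (h : IsPDirectSum p X Y) (hp : 1 ≤ p) {x : H →L[ℂ] H} (hx : x ∈ X) :
    ∃ f : ι → H →L[ℂ] H, (∀ i, f i ∈ Y i) ∧ HasSum f x := by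
  obtain ⟨f, hf, -, hs⟩ := (h.mem_iff x).1 hx
  exact ⟨f, hf, hs.hasSum hp⟩

theorem mem_of_hasSum (h : IsPDirectSum p X Y) (hp : 1 ≤ p)
    (hY : ∀ i, (Y i : Set (H →L[ℂ] H)) ⊆ schatten H p) {f : ι → H →L[ℂ] H} {x : H →L[ℂ] H}
    (hf : ∀ i, f i ∈ Y i) (hs : ∑' i, traceAbsRpow p (f i) ≠ ∞) (hx : HasSum f x) : x ∈ X := by
  refine (h.mem_iff x).2 ⟨f, hf, ?_, ?_⟩
  · simp_rw [schattenNorm_rpow hp]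
    exact hs.lt_top
  · exact hasSchattenSum_of_disjoint hp hx (fun i => hY i (hf i))
      (fun i j hij => h.pairwise_disjoint hij _ (hf i) _ (hf j)) hs

theorem le (h : IsPDirectSum p X Y) (hp : 1 ≤ p)
    (hY : ∀ i, (Y i : Set (H →L[ℂ] H)) ⊆ schatten H p) (i : ι) : Y i ≤ X := by
  classical
  intro y hy
  have h0 : traceAbsRpow p (0 : H →L[ℂ] H) = 0 := by
    simpa [traceAbsRpow, trace] using
      congrArg (trace (H := H)) (CFC.zero_rpow (A := H →L[ℂ] H) (x := p) (by linarith))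
  refine h.mem_of_hasSum hp hY (f := Pi.single i y) (fun j => ?_) ?_ (hasSum_pi_single i y)
  · by_cases hij : j = i
    · subst hij
      simpa using hy
    · simp [hij]
  · rw [tsum_eq_single i fun j hj => by simp [hj, h0]]
    simpa using (mem_schatten_iff.1 (hY i hy)).ne

theorem positivelyOneComplemented_component (h : IsPDirectSum p X Y) (hp : 1 ≤ p)
    (hY : ∀ i, (Y i : Set (H →L[ℂ] H)) ⊆ schatten H p)
    (hX : PositivelyOneComplemented p X) (i : ι) : PositivelyOneComplemented p (Y i) := by
  obtain ⟨P, hP, hPX⟩ := hX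
  have hPm {x : H →L[ℂ] H} (hx : x ∈ schatten H p) : P x ∈ X := by
    rw [← SetLike.mem_coe, ← hPX]
    exact ⟨x, hx, rfl⟩
  have hex (x : H →L[ℂ] H) : ∃ f : ι → H →L[ℂ] H,
      x ∈ schatten H p → (∀ i, f i ∈ Y i) ∧ HasSum f (P x) := by
    by_cases hx : x ∈ schatten H p
    · obtain ⟨f, hf⟩ := h.exists_hasSum hp (hPm hx)
      exact ⟨f, fun _ => hf⟩
    · exact ⟨0, fun hx' => (hx hx').elim⟩
  choose Q hQ using hex
  -- Any decomposition of `P x` along `Y` computes `Q x i`; this gives linearity of the chosen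
  -- components.
  have huniq {x : H →L[ℂ] H} (hx : x ∈ schatten H p) {g : ι → H →L[ℂ] H} (hg : ∀ i, g i ∈ Y i)
      (hgs : HasSum g (P x)) : Q x i = g i :=
    eq_of_hasSum_of_hasSum h.pairwise_disjoint (hQ x hx).2 hgs (hQ x hx).1 hg i
  have hQY {x : H →L[ℂ] H} (hx : x ∈ schatten H p) : Q x i ∈ Y i := (hQ x hx).1 i
  have hQfix {y : H →L[ℂ] H} (hy : y ∈ Y i) : Q y i = y := by
    classical
    have h1 := huniq (hY i hy) (g := Pi.single i y) (fun j => ?_) ?_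
    · simpa using h1
    · by_cases hij : j = i
      · subst hij
        simpa using hy
      · simp [hij]
    · rw [hP.apply_eq_of_mem hPX (h.le hp hY i hy)]
      exact hasSum_pi_single i y
  have hdisj {x : H →L[ℂ] H} (hx : x ∈ schatten H p) : Disjoint (Q x i) (P x - Q x i) :=
    disjoint_sub_of_hasSum (hQ x hx).2
      (fun j k hjk => h.pairwise_disjoint hjk _ ((hQ x hx).1 j) _ ((hQ x hx).1 k)) i
  refine ⟨fun x => Q x i, ⟨fun x hx => hY i (hQY hx), ?_, ?_, fun x hx => hQfix (hQY hx), ?_, ?_⟩,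
    ?_⟩
  · intro x hx y hy
    refine huniq ((schattenSubmodule H p hp).add_mem hx hy)
      (g := fun j => Q x j + Q y j) (fun j => add_mem ((hQ x hx).1 j) ((hQ y hy).1 j)) ?_
    rw [hP.map_add x hx y hy]
    exact (hQ x hx).2.add (hQ y hy).2
  · intro c x hx
    refine huniq ((schattenSubmodule H p hp).smul_mem c hx)
      (g := fun j => c • Q x j) (fun j => Submodule.smul_mem _ c ((hQ x hx).1 j)) ?_
    rw [hP.map_smul c x hx]
    exact (hQ x hx).2.const_smul c
  · intro x hx
    refine le_trans ?_ (hP.contractive x hx)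
    rw [schattenNorm_le_iff hp]
    have h1 := traceAbsRpow_le_of_disjoint hp (hY i (hQY hx)) (hdisj hx)
    rwa [add_sub_cancel] at h1
  · intro x hx hx0
    rw [← ContinuousLinearMap.nonneg_iff_isPositive]
    refine nonneg_of_disjoint_of_add_nonneg (hdisj hx) ?_
    rw [add_sub_cancel]
    exact (ContinuousLinearMap.nonneg_iff_isPositive _).2 (hP.positive x hx hx0)
  · refine Set.Subset.antisymm ?_ fun y hy => ⟨y, hY i hy, hQfix hy⟩
    rintro _ ⟨x, hx, rfl⟩
    exact hQY hx

theorem positivelyOneComplemented_of_components (h : IsPDirectSum p X Y) (hp : 1 ≤ p)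
    (hX : (X : Set (H →L[ℂ] H)) ⊆ schatten H p)
    (hY : ∀ i, (Y i : Set (H →L[ℂ] H)) ⊆ schatten H p)
    (hc : ∀ i, PositivelyOneComplemented p (Y i)) : PositivelyOneComplemented p X := by
  choose P hP hPY using hc
  let q : ι → H →L[ℂ] H := fun i => rangeProj (Y i)
  have hq (i : ι) : IsStarProjection (q i) := isStarProjection_rangeProj (Y i)
  have hqq (i j : ι) (hij : i ≠ j) : q i * q j = 0 :=
    rangeProj_mul_rangeProj (h.pairwise_disjoint hij)
  have hPm {i : ι} {x : H →L[ℂ] H} (hx : x ∈ schatten H p) : P i x ∈ Y i := by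
    rw [← SetLike.mem_coe, ← hPY]
    exact ⟨x, hx, rfl⟩
  -- `Y i` is self-adjoint as the range of a star-preserving map, so `q i` acts as a unit on the
  -- right as well.
  have hstar {i : ι} {y : H →L[ℂ] H} (hy : y ∈ Y i) : star y ∈ Y i := by
    rw [← (hP i).apply_eq_of_mem (hPY i) hy, ← (hP i).map_star hp (hY i hy)]
    exact hPm (star_mem_schatten hp (hY i hy))
  have hqy {i : ι} {y : H →L[ℂ] H} (hy : y ∈ Y i) : q i * y * q i = y := by
    rw [rangeProj_mul hy, mul_rangeProj (hstar hy)]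
  have hqy' {i j : ι} (hij : i ≠ j) {y : H →L[ℂ] H} (hy : y ∈ Y j) : q i * y * q i = 0 := by
    rw [← hqy hy]
    simp only [← mul_assoc, hqq i j hij, zero_mul]
  have hsum {x : H →L[ℂ] H} (hx : x ∈ schatten H p) :
      ∑' i, traceAbsRpow p (q i * x * q i) ≤ traceAbsRpow p x :=
    tsum_traceAbsRpow_compress_le hp hq hqq hx
  have hqx {x : H →L[ℂ] H} (hx : x ∈ schatten H p) (i : ι) : q i * x * q i ∈ schatten H p :=
    ((ENNReal.le_tsum i).trans (hsum hx)).trans_lt hx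
  have hR {x : H →L[ℂ] H} (hx : x ∈ schatten H p) :
      ∑' i, traceAbsRpow p (P i (q i * x * q i)) ≤ traceAbsRpow p x := by
    refine (ENNReal.tsum_le_tsum fun i => ?_).trans (hsum hx)
    exact (schattenNorm_le_iff hp _ _).1 ((hP i).contractive _ (hqx hx i))
  have hRd {x : H →L[ℂ] H} (hx : x ∈ schatten H p) :
      Pairwise fun i j => Disjoint (P i (q i * x * q i)) (P j (q j * x * q j)) :=
    fun i j hij => h.pairwise_disjoint hij _ (hPm (hqx hx i)) _ (hPm (hqx hx j))
  have hRs {x : H →L[ℂ] H} (hx : x ∈ schatten H p) :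
      HasSum (fun i => P i (q i * x * q i)) (∑' i, P i (q i * x * q i)) :=
    (summable_of_disjoint hp (fun i => (hP i).map_mem _ (hqx hx i)) (hRd hx)
      ((hR hx).trans_lt hx).ne).hasSum
  have hRX {x : H →L[ℂ] H} (hx : x ∈ schatten H p) : ∑' i, P i (q i * x * q i) ∈ X :=
    h.mem_of_hasSum hp hY (fun i => hPm (hqx hx i)) ((hR hx).trans_lt hx).ne (hRs hx)
  have hfix {x : H →L[ℂ] H} (hx : x ∈ X) : ∑' i, P i (q i * x * q i) = x := by
    obtain ⟨f, hf, hs⟩ := h.exists_hasSum hp hx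
    refine (tsum_congr fun i => ?_).trans hs.tsum_eq
    -- Compression by `q i` removes every component of `x` except the `i`-th.
    have h1 : q i * x * q i = q i * f i * q i :=
      ((hs.mul_left (q i)).mul_right (q i)).unique
        (hasSum_single i fun j hj => hqy' hj.symm (hf j))
    rw [h1, hqy (hf i), (hP i).apply_eq_of_mem (hPY i) (hf i)]
  refine ⟨fun x => ∑' i, P i (q i * x * q i), ⟨fun x hx => hX (hRX hx), ?_, ?_,
    fun x hx => hfix (hRX hx), ?_, ?_⟩, ?_⟩
  · intro x hx y hy
    rw [← (hRs hx).summable.tsum_add (hRs hy).summable]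
    refine tsum_congr fun i => ?_
    rw [← (hP i).map_add _ (hqx hx i) _ (hqx hy i), mul_add, add_mul]
  · intro c x hx
    rw [← (hRs hx).summable.tsum_const_smul c]
    refine tsum_congr fun i => ?_
    rw [← (hP i).map_smul c _ (hqx hx i), mul_smul_comm, smul_mul_assoc]
  · intro x hx
    rw [schattenNorm_le_iff hp]
    exact (traceAbsRpow_le_tsum_of_disjoint hp (hRs hx)
      (fun i => (hP i).map_mem _ (hqx hx i)) (hRd hx)).trans (hR hx)
  · intro x hx hx0
    rw [← ContinuousLinearMap.nonneg_iff_isPositive] at hx0 ⊢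
    refine tsum_nonneg fun i => ?_
    rw [ContinuousLinearMap.nonneg_iff_isPositive]
    refine (hP i).positive _ (hqx hx i) ?_
    rw [← ContinuousLinearMap.nonneg_iff_isPositive]
    exact (hq i).isSelfAdjoint.conjugate_nonneg hx0
  · refine Set.Subset.antisymm ?_ fun x hx => ⟨x, hX hx, hfix hx⟩
    rintro _ ⟨x, hx, rfl⟩
    exact hRX hx

end IsPDirectSum

end PosSchatten

theorem lemma4p2 {H : Type*} [NormedAddCommGroup H] [InnerProductSpace ℂ H] [CompleteSpace H]
    {ι : Type*} (p : ℝ) (hp : 1 < p)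
    (X : Submodule ℂ (H →L[ℂ] H)) (Y : ι → Submodule ℂ (H →L[ℂ] H))
    (hX : (X : Set (H →L[ℂ] H)) ⊆ PosSchatten.schatten H p)
    (hY : ∀ α, (Y α : Set (H →L[ℂ] H)) ⊆ PosSchatten.schatten H p)
    (hind : ∀ α, PosSchatten.Indecomposable (Y α))
    (hsum : PosSchatten.IsPDirectSum p X Y) :
    PosSchatten.PositivelyOneComplemented p X ↔
      ∀ α, PosSchatten.PositivelyOneComplemented p (Y α) :=
  ⟨fun h => hsum.positivelyOneComplemented_component hp.le hY h,
    hsum.positivelyOneComplemented_of_components hp.le hX hY⟩
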